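/- Let the terms be built from variables and the constants $C, T, F, K, S$ by a binary application, written as juxtaposition and associating to the left. Let $\mathrm{CLC}$ be the conditional term rewriting system with the rules \[ C\,T\,x\,y \to x,\qquad C\,F\,x\,y \to y,\qquad C\,z\,x\,y \to x \;\Leftarrow\; x = y,\qquad K\,x\,y \to x,\qquad S\,x\,y\,z \to x\,z\,(y\,z), \] where the equality in the condition is that of $\mathrm{CLC}$ itself. Formally, $\to_0$ is one-step contraction (of a redex at any position) by these rules with the empty relation in place of $=$; $\to_{n+1}$ is the same with $=$ read as the least equivalence relation containing $\to_n$; and $q \to_{\mathrm{CLC}} q'$ means that $q \to_n q'$ for some $n \in \mathbb{N}$. Let $\to^*_{\mathrm{CLC}}$ be the reflexive-transitive closure of $\to_{\mathrm{CLC}}$, and $=_{\mathrm{CLC}}$ the least equivalence relation containing $\to_{\mathrm{CLC}}$. Then for every term $q$, if $q =_{\mathrm{CLC}} F$ then $q \to^*_{\mathrm{CLC}} F$. Consequently, $T \neq_{\mathrm{CLC}} F$. -/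

import Mathlib

namespace CLC

universe u

/-- Terms of combinatory logic with Boolean constants, over a type `V` of variables. -/
inductive Term (V : Type u) : Type u
  | var : V → Term V
  | C : Term V
  | T : Term V
  | F : Term V
  | K : Term V
  | S : Term V
  | app : Term V → Term V → Term V

/-- Application, associating to the left. -/
infixl:75 " ⬝ " => Term.app

/-- Instances of the five rewrite rules (contraction at the root), where the relation `E`
interprets the equality in the condition of the third rule. -/
inductive Root {V : Type u} (E : Term V → Term V → Prop) : Term V → Term V → Prop
  | condT (x y : Term V) : Root E (Term.C ⬝ Term.T ⬝ x ⬝ y) x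
  | condF (x y : Term V) : Root E (Term.C ⬝ Term.F ⬝ x ⬝ y) y
  | condEq (z x y : Term V) (h : E x y) : Root E (Term.C ⬝ z ⬝ x ⬝ y) x
  | k (x y : Term V) : Root E (Term.K ⬝ x ⬝ y) x
  | s (x y z : Term V) : Root E (Term.S ⬝ x ⬝ y ⬝ z) (x ⬝ z ⬝ (y ⬝ z))

/-- Contraction of one redex at any position, with `E` interpreting the condition. -/
inductive Contr {V : Type u} (E : Term V → Term V → Prop) : Term V → Term V → Prop
  | root {q q' : Term V} (h : Root E q q') : Contr E q q'
  | appLeft {q q' : Term V} (r : Term V) (h : Contr E q q') : Contr E (q ⬝ r) (q' ⬝ r)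
  | appRight (r : Term V) {q q' : Term V} (h : Contr E q q') : Contr E (r ⬝ q) (r ⬝ q')

/-- Contraction in the `n`-th approximation of the system: at level `0` the equality in the
condition is the empty relation, at level `n + 1` it is convertibility at level `n`. -/
def StepAt {V : Type u} : ℕ → Term V → Term V → Prop
  | 0 => Contr (fun _ _ => False)
  | n + 1 => Contr (Relation.EqvGen (StepAt n))

/-- One-step contraction of CLC. -/
def Step {V : Type u} (q q' : Term V) : Prop := ∃ n : ℕ, StepAt n q q'

/-- Reduction: the reflexive-transitive closure of contraction. -/
def Red {V : Type u} : Term V → Term V → Prop := Relation.ReflTransGen Step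

/-- Equality (convertibility): the least equivalence relation containing contraction. -/
def Conv {V : Type u} : Term V → Term V → Prop := Relation.EqvGen Step

end CLC

namespace CLC

variable {V : Type*}

/-! No confluence is used: the proof builds a token model, like a filter model of combinatory logic.
Arrow tokens also record their argument up to convertibility, so `C` can test its branches for
equality inside the model. Convertible terms have the same tokens (`Conv.tokens_eq`), and every term
realizes its tokens (`realizes_of_mem_tokens`), where realizing `ff` means reducing to `F`. A term
convertible to `F` inherits its token `ff`, hence reduces to `F`; `T` lacks this token. -/

theorem conv_equivalence : Equivalence (Conv (V := V)) := Relation.EqvGen.is_equivalence Step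

theorem Conv.symm {s t : Term V} (h : Conv s t) : Conv t s := conv_equivalence.symm h

theorem Conv.trans {s t r : Term V} (h : Conv s t) (h' : Conv t r) : Conv s r :=
  conv_equivalence.trans h h'

theorem Conv.of_stepAt {n : ℕ} {s t : Term V} (h : StepAt n s t) : Conv s t :=
  .rel _ _ ⟨n, h⟩

theorem Contr.mono {E E' : Term V → Term V → Prop} (hE : ∀ s t, E s t → E' s t)
    {s t : Term V} (h : Contr E s t) : Contr E' s t := by
  induction h with
  | root h =>
    refine .root ?_
    cases h with
    | condT => exact .condT _ _
    | condF => exact .condF _ _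
    | condEq _ _ _ h => exact .condEq _ _ _ (hE _ _ h)
    | k => exact .k _ _
    | s => exact .s _ _ _
  | appLeft r _ ih => exact .appLeft r ih
  | appRight r _ ih => exact .appRight r ih

theorem StepAt.succ {n : ℕ} {s t : Term V} (h : StepAt n s t) : StepAt (n + 1) s t := by
  induction n generalizing s t with
  | zero => exact Contr.mono (fun _ _ h => h.elim) h
  | succ n ih => exact Contr.mono (fun _ _ h => h.mono fun _ _ => ih) h

theorem StepAt.mono {m n : ℕ} (hmn : m ≤ n) {s t : Term V} (h : StepAt m s t) :
    StepAt n s t := by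
  induction hmn with
  | refl => exact h
  | step _ ih => exact ih.succ

/-- A conversion uses only finitely many levels of the stratification. -/
theorem Conv.exists_level {s t : Term V} (h : Conv s t) :
    ∃ n, Relation.EqvGen (StepAt n) s t := by
  induction h with
  | rel _ _ h => exact h.imp fun n h => .rel _ _ h
  | refl => exact ⟨0, .refl _⟩
  | symm _ _ _ ih => exact ih.imp fun n h => .symm _ _ h
  | trans _ _ _ _ _ ih₁ ih₂ =>
    obtain ⟨m, hm⟩ := ih₁
    obtain ⟨n, hn⟩ := ih₂
    exact ⟨max m n, .trans _ _ _ (hm.mono fun _ _ => StepAt.mono (le_max_left m n))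
      (hn.mono fun _ _ => StepAt.mono (le_max_right m n))⟩

theorem step_condT (x y : Term V) : Step (Term.C ⬝ Term.T ⬝ x ⬝ y) x :=
  ⟨0, .root (.condT x y)⟩

theorem step_condF (x y : Term V) : Step (Term.C ⬝ Term.F ⬝ x ⬝ y) y :=
  ⟨0, .root (.condF x y)⟩

/-- The union of the levels is closed under the conditional rule, since a conversion lives on a
single level. -/
theorem step_condEq (z : Term V) {x y : Term V} (h : Conv x y) :
    Step (Term.C ⬝ z ⬝ x ⬝ y) x := by
  obtain ⟨n, hn⟩ := h.exists_level
  exact ⟨n + 1, .root (.condEq z x y hn)⟩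

theorem step_k (x y : Term V) : Step (Term.K ⬝ x ⬝ y) x := ⟨0, .root (.k x y)⟩

theorem step_s (x y z : Term V) : Step (Term.S ⬝ x ⬝ y ⬝ z) (x ⬝ z ⬝ (y ⬝ z)) :=
  ⟨0, .root (.s x y z)⟩

theorem StepAt.appLeft {n : ℕ} {s t : Term V} (r : Term V) (h : StepAt n s t) :
    StepAt n (s ⬝ r) (t ⬝ r) := by
  cases n <;> exact Contr.appLeft r h

theorem StepAt.appRight {n : ℕ} (r : Term V) {s t : Term V} (h : StepAt n s t) :
    StepAt n (r ⬝ s) (r ⬝ t) := by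
  cases n <;> exact Contr.appRight r h

theorem Step.appLeft {s t : Term V} (r : Term V) (h : Step s t) : Step (s ⬝ r) (t ⬝ r) :=
  h.imp fun _ h => h.appLeft r

theorem Step.appRight (r : Term V) {s t : Term V} (h : Step s t) : Step (r ⬝ s) (r ⬝ t) :=
  h.imp fun _ h => h.appRight r

theorem Red.appLeft {s t : Term V} (r : Term V) (h : Red s t) : Red (s ⬝ r) (t ⬝ r) :=
  Relation.ReflTransGen.lift (· ⬝ r) (fun _ _ => Step.appLeft r) _ _ h

theorem Red.appRight (r : Term V) {s t : Term V} (h : Red s t) : Red (r ⬝ s) (r ⬝ t) :=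
  Relation.ReflTransGen.lift (r ⬝ ·) (fun _ _ => Step.appRight r) _ _ h

theorem Conv.appLeft {s t : Term V} (r : Term V) (h : Conv s t) : Conv (s ⬝ r) (t ⬝ r) := by
  induction h with
  | rel _ _ h => exact .rel _ _ (h.appLeft r)
  | refl => exact .refl _
  | symm _ _ _ ih => exact Conv.symm ih
  | trans _ _ _ _ _ ih₁ ih₂ => exact Conv.trans ih₁ ih₂

theorem Conv.appRight (r : Term V) {s t : Term V} (h : Conv s t) : Conv (r ⬝ s) (r ⬝ t) := by
  induction h with
  | rel _ _ h => exact .rel _ _ (h.appRight r)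
  | refl => exact .refl _
  | symm _ _ _ ih => exact Conv.symm ih
  | trans _ _ _ _ _ ih₁ ih₂ => exact Conv.trans ih₁ ih₂

theorem Conv.app {s s' t t' : Term V} (h : Conv s s') (h' : Conv t t') :
    Conv (s ⬝ t) (s' ⬝ t') :=
  (h.appLeft t).trans (h'.appRight s')

/-! ### The token model -/

/-- Finite pieces of information about a term. The token `arr u α b` says that applying the term
to an argument which is convertible to `u` and has all the tokens in `α` yields a term with
token `b`. -/
inductive Token (V : Type*)
  | tt : Token V
  | ff : Token V
  | arr : Term V → List (Token V) → Token V → Token V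

/-- Application of a set of tokens to an argument `r` having the tokens in `B`. -/
def tokenApp (A : Set (Token V)) (r : Term V) (B : Set (Token V)) : Set (Token V) :=
  {b | ∃ u α, Conv u r ∧ (∀ a ∈ α, a ∈ B) ∧ Token.arr u α b ∈ A}

theorem tokenApp_mono {A A' B B' : Set (Token V)} {r r' : Term V} (hA : A ⊆ A')
    (hr : Conv r r') (hB : B ⊆ B') : tokenApp A r B ⊆ tokenApp A' r' B' := by
  rintro b ⟨u, α, hu, hα, hb⟩
  exact ⟨u, α, hu.trans hr, fun a ha => hB (hα a ha), hA hb⟩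

theorem tokenApp_congr (A B : Set (Token V)) {r r' : Term V} (hr : Conv r r') :
    tokenApp A r B = tokenApp A r' B :=
  (tokenApp_mono subset_rfl hr subset_rfl).antisymm
    (tokenApp_mono subset_rfl hr.symm subset_rfl)

/-- The tokens of `C`. The third kind expresses the parallel conditional: two convertible
branches pass on their common tokens, whatever the Boolean argument is. -/
inductive CondToken : Token V → Prop
  | tt (u v w : Term V) (a : Token V) :
      CondToken (.arr u [.tt] (.arr v [a] (.arr w [] a)))
  | ff (u v w : Term V) (a : Token V) :
      CondToken (.arr u [.ff] (.arr v [] (.arr w [a] a)))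
  | eq (u v w : Term V) (a : Token V) (h : Conv v w) :
      CondToken (.arr u [] (.arr v [a] (.arr w [a] a)))

/-- The tokens of `K`. -/
inductive KToken : Token V → Prop
  | intro (u v : Term V) (a : Token V) : KToken (.arr u [a] (.arr v [] a))

/-- The tokens of `S`. -/
inductive SToken : Token V → Prop
  | intro (u v w : Term V) (α β γ : List (Token V)) (b : Token V)
      (h : b ∈ tokenApp (tokenApp {a | a ∈ α} w {a | a ∈ γ}) (v ⬝ w)
        (tokenApp {a | a ∈ β} w {a | a ∈ γ})) :
      SToken (.arr u α (.arr v β (.arr w γ b)))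

/-- The set of tokens of a term. -/
def tokens : Term V → Set (Token V)
  | .var _ => ∅
  | .C => {a | CondToken a}
  | .T => {.tt}
  | .F => {.ff}
  | .K => {a | KToken a}
  | .S => {a | SToken a}
  | .app t r => tokenApp (tokens t) r (tokens r)

/-! ### Invariance of tokens under conversion -/

theorem mem_tokens_cond {z x y : Term V} {a : Token V} :
    a ∈ tokens (Term.C ⬝ z ⬝ x ⬝ y) ↔
      (.tt ∈ tokens z ∧ a ∈ tokens x) ∨ (.ff ∈ tokens z ∧ a ∈ tokens y) ∨
        (Conv x y ∧ a ∈ tokens x ∧ a ∈ tokens y) := by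
  constructor
  · rintro ⟨w, γ, hw, hγ, v, β, hv, hβ, u, α, hu, hα, h⟩
    cases h with
    | tt => exact .inl ⟨hα _ (by simp), hβ _ (by simp)⟩
    | ff => exact .inr (.inl ⟨hα _ (by simp), hγ _ (by simp)⟩)
    | eq _ _ _ _ h =>
      exact .inr (.inr ⟨hv.symm.trans (h.trans hw), hβ _ (by simp), hγ _ (by simp)⟩)
  · rintro (⟨hz, hx⟩ | ⟨hz, hy⟩ | ⟨h, hx, hy⟩)
    · exact ⟨y, [], .refl _, by simp, x, [a], .refl _, by simpa, z, [.tt], .refl _, by simpa,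
        .tt z x y a⟩
    · exact ⟨y, [a], .refl _, by simpa, x, [], .refl _, by simp, z, [.ff], .refl _, by simpa,
        .ff z x y a⟩
    · exact ⟨y, [a], .refl _, by simpa, x, [a], .refl _, by simpa, z, [], .refl _, by simp,
        .eq z x y a h⟩

theorem tokens_k (x y : Term V) : tokens (Term.K ⬝ x ⬝ y) = tokens x := by
  ext a
  constructor
  · rintro ⟨v, β, hv, hβ, u, α, hu, hα, h⟩
    cases h
    exact hα _ (by simp)
  · intro h
    exact ⟨y, [], .refl _, by simp, x, [a], .refl _, by simpa, .intro x y a⟩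

/-- Continuity of application. -/
theorem exists_list_of_forall_mem_tokenApp {A B : Set (Token V)} {r : Term V}
    {δ : List (Token V)} (h : ∀ d ∈ δ, d ∈ tokenApp A r B) :
    ∃ β γ : List (Token V), (∀ b ∈ β, b ∈ A) ∧ (∀ c ∈ γ, c ∈ B) ∧
      ∀ d ∈ δ, d ∈ tokenApp {b | b ∈ β} r {c | c ∈ γ} := by
  induction δ with
  | nil => exact ⟨[], [], by simp, by simp, by simp⟩
  | cons d δ ih =>
    obtain ⟨β, γ, hβ, hγ, hδ⟩ := ih fun e he => h e (by simp [he])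
    obtain ⟨u, γ', hu, hγ', hd⟩ := h d (by simp)
    refine ⟨.arr u γ' d :: β, γ' ++ γ, ?_, ?_, ?_⟩
    · simpa using ⟨hd, hβ⟩
    · simpa [or_imp, forall_and] using ⟨hγ', hγ⟩
    · intro e he
      rcases List.mem_cons.1 he with rfl | he
      · exact ⟨u, γ', hu, fun a ha => by simp [ha], by simp⟩
      · exact tokenApp_mono (fun b hb => by simp_all) (.refl _) (fun c hc => by simp_all)
          (hδ e he)

theorem tokens_s (x y z : Term V) :
    tokens (Term.S ⬝ x ⬝ y ⬝ z) = tokens (x ⬝ z ⬝ (y ⬝ z)) := by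
  ext b
  constructor
  · rintro ⟨w, γ, hw, hγ, v, β, hv, hβ, u, α, hu, hα, h⟩
    cases h with
    | intro _ _ _ _ _ _ _ h =>
      exact tokenApp_mono (tokenApp_mono hα hw hγ) (hv.app hw) (tokenApp_mono hβ hw hγ) h
  · rintro ⟨u, δ, hu, hδ, v, γ, hv, hγ, h⟩
    obtain ⟨β, γ', hβ, hγ', hδ'⟩ := exists_list_of_forall_mem_tokenApp hδ
    -- `S` tokens carry finite lists: one token of `x` suffices, and continuity bounds what is
    -- needed of `y` and `z`.
    refine ⟨z, γ ++ γ', .refl _, ?_, y, β, .refl _, hβ, x, [.arr v γ (.arr u δ b)], .refl _, ?_,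
      .intro _ _ _ _ _ _ _ ?_⟩
    · simpa [or_imp, forall_and] using ⟨hγ, hγ'⟩
    · simpa using h
    · exact ⟨u, δ, hu, fun d hd => tokenApp_mono subset_rfl (.refl _)
        (fun c hc => by simp_all) (hδ' d hd), v, γ, hv, fun a ha => by simp [ha], by simp⟩

theorem tokens_eq_of_root {E : Term V → Term V → Prop}
    (hE : ∀ s t, E s t → Conv s t ∧ tokens s = tokens t) {s t : Term V} (h : Root E s t) :
    tokens s = tokens t := by
  cases h with
  | condT =>
    ext a
    rw [mem_tokens_cond]
    simp only [tokens, Set.mem_singleton_iff, reduceCtorEq]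
    tauto
  -- The third disjunct asks for `a` in both branches, so it is harmless here although invariance is
  -- not yet known.
  | condF =>
    ext a
    rw [mem_tokens_cond]
    simp only [tokens, Set.mem_singleton_iff, reduceCtorEq]
    tauto
  | condEq _ _ _ h =>
    obtain ⟨hc, ht⟩ := hE _ _ h
    ext a
    rw [mem_tokens_cond, ← ht]
    tauto
  | k => exact tokens_k _ _
  | s x y z => exact tokens_s x y z

theorem tokens_eq_of_contr {E : Term V → Term V → Prop}
    (hE : ∀ s t, E s t → Conv s t ∧ tokens s = tokens t)
    (hC : ∀ s t, Contr E s t → Conv s t) {s t : Term V} (h : Contr E s t) :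
    tokens s = tokens t := by
  induction h with
  | root h => exact tokens_eq_of_root hE h
  | appLeft r _ ih => simp only [tokens, ih]
  -- `tokenApp` sees the argument itself, but only up to convertibility; hence `hC`.
  | appRight r h ih => simp only [tokens, ih, tokenApp_congr _ _ (hC _ _ h)]

theorem tokens_eq_of_eqvGen {R : Term V → Term V → Prop}
    (hR : ∀ s t, R s t → tokens s = tokens t) {s t : Term V} (h : Relation.EqvGen R s t) :
    tokens s = tokens t := by
  induction h with
  | rel _ _ h => exact hR _ _ h
  | refl => rfl
  | symm _ _ _ ih => exact ih.symm
  | trans _ _ _ _ _ ih₁ ih₂ => exact ih₁.trans ih₂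

/-- A condition at level `n + 1` is a conversion at level `n`, so the induction hypothesis gives its
two sides equal tokens. -/
theorem tokens_eq_of_stepAt {n : ℕ} {s t : Term V} (h : StepAt n s t) :
    tokens s = tokens t := by
  induction n generalizing s t with
  | zero =>
    exact tokens_eq_of_contr (fun _ _ h => h.elim) (fun _ _ h => Conv.of_stepAt (n := 0) h) h
  | succ n ih =>
    exact tokens_eq_of_contr
      (fun _ _ h => ⟨h.mono fun _ _ h => ⟨n, h⟩, tokens_eq_of_eqvGen (fun _ _ => ih) h⟩)
      (fun _ _ h => Conv.of_stepAt (n := n + 1) h) h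

/-- Convertible terms have the same tokens. -/
theorem Conv.tokens_eq {s t : Term V} (h : Conv s t) : tokens s = tokens t :=
  tokens_eq_of_eqvGen (fun _ _ ⟨_, h⟩ => tokens_eq_of_stepAt h) h

/-! ### Realizability and adequacy -/

/-- The computational meaning of tokens. -/
def Realizes : Token V → Term V → Prop
  | .tt, t => Red t .T
  | .ff, t => Red t .F
  | .arr u α b, t => ∀ r, Conv u r → (∀ a ∈ α, Realizes a r) → Realizes b (t ⬝ r)

theorem realizes_arr {u : Term V} {α : List (Token V)} {b : Token V} {t : Term V} :
    Realizes (.arr u α b) t ↔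
      ∀ r, Conv u r → (∀ a ∈ α, Realizes a r) → Realizes b (t ⬝ r) := by
  rw [Realizes]

/-- Closure under expansion is the only closure property adequacy needs. -/
theorem Realizes.of_red {s t : Term V} (h : Red s t) :
    ∀ {a : Token V}, Realizes a t → Realizes a s
  | .tt, ht => by
    rw [Realizes] at ht ⊢
    exact Relation.ReflTransGen.trans h ht
  | .ff, ht => by
    rw [Realizes] at ht ⊢
    exact Relation.ReflTransGen.trans h ht
  | .arr u α b, ht => by
    rw [realizes_arr] at ht ⊢
    exact fun r hu hα => Realizes.of_red (h.appLeft r) (ht r hu hα)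

theorem Realizes.of_step {s t : Term V} (h : Step s t) {a : Token V} (ht : Realizes a t) :
    Realizes a s :=
  .of_red (.single h) ht

theorem realizes_of_mem_tokenApp {A B : Set (Token V)} {t r : Term V}
    (hA : ∀ a ∈ A, Realizes a t) (hB : ∀ a ∈ B, Realizes a r) :
    ∀ b ∈ tokenApp A r B, Realizes b (t ⬝ r) := by
  rintro b ⟨u, α, hu, hα, hb⟩
  exact realizes_arr.1 (hA _ hb) r hu fun a ha => hB a (hα a ha)

theorem CondToken.realizes {a : Token V} (h : CondToken a) : Realizes a .C := by
  cases h with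
  | tt u v w a =>
    simp only [realizes_arr, List.forall_mem_singleton]
    intro z _ hz x _ hx y _ _
    rw [Realizes] at hz
    exact .of_red (((hz.appRight _).appLeft x).appLeft y) (.of_step (step_condT x y) hx)
  | ff u v w a =>
    simp only [realizes_arr, List.forall_mem_singleton]
    intro z _ hz x _ _ y _ hy
    rw [Realizes] at hz
    exact .of_red (((hz.appRight _).appLeft x).appLeft y) (.of_step (step_condF x y) hy)
  | eq u v w a h =>
    simp only [realizes_arr, List.forall_mem_singleton]
    intro z _ _ x hv hx y hw _
    -- The arguments are convertible to `v` and `w`, hence to each other, so the third rule fires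
    -- whatever `z` is.
    exact .of_step (step_condEq z (hv.symm.trans (h.trans hw))) hx

theorem KToken.realizes {a : Token V} (h : KToken a) : Realizes a .K := by
  cases h
  simp only [realizes_arr, List.forall_mem_singleton]
  intro x _ hx y _ _
  exact .of_step (step_k x y) hx

theorem SToken.realizes {a : Token V} (h : SToken a) : Realizes a .S := by
  cases h with
  | intro u v w α β γ b h =>
    simp only [realizes_arr]
    intro x _ hx y hv hy z hw hz
    refine .of_step (step_s x y z) ?_
    refine realizes_of_mem_tokenApp (realizes_of_mem_tokenApp hx hz)
      (realizes_of_mem_tokenApp hy hz) b ?_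
    exact tokenApp_mono (tokenApp_mono subset_rfl hw subset_rfl) (hv.app hw)
      (tokenApp_mono subset_rfl hw subset_rfl) h

/-- Adequacy: every term realizes its tokens. -/
theorem realizes_of_mem_tokens (t : Term V) : ∀ a ∈ tokens t, Realizes a t := by
  induction t with
  | var => exact fun _ h => h.elim
  | C => exact fun _ => CondToken.realizes
  | T =>
    rintro _ rfl
    rw [Realizes]
    exact .refl
  | F =>
    rintro _ rfl
    rw [Realizes]
    exact .refl
  | K => exact fun _ => KToken.realizes
  | S => exact fun _ => SToken.realizes
  | app t r iht ihr => exact realizes_of_mem_tokenApp iht ihr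

theorem Conv.red_F {q : Term V} (h : Conv q .F) : Red q .F := by
  have hq : Token.ff ∈ tokens q := by
    rw [h.tokens_eq]
    rfl
  simpa only [Realizes] using realizes_of_mem_tokens q _ hq

theorem not_conv_T_F : ¬ Conv (.T : Term V) .F := by
  intro h
  have hT : Token.ff ∈ tokens (.T : Term V) := by
    rw [h.tokens_eq]
    rfl
  cases hT

end CLC

theorem mainTheorem2 {V : Type*} :
    (∀ q : CLC.Term V, CLC.Conv q CLC.Term.F → CLC.Red q CLC.Term.F) ∧
      ¬ CLC.Conv (CLC.Term.T : CLC.Term V) CLC.Term.F :=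
  ⟨fun _ h => h.red_F, CLC.not_conv_T_F⟩
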